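/- Let $X$ be a real Banach space and let $\alpha\in(0,1)$. Then the following are equivalent: 1. $X$ is reflexive. 2. $X$ has the fixed point property for $\alpha$-Hölder nonexpansive affine maps, i.e. for every nonempty bounded closed convex set $K\subseteq X$ and every affine map $T\colon K\to K$ with $\|Tx-Ty\|\le\|x-y\|^{\alpha}$ for all $x,y\in K$, there is $x\in K$ with $Tx=x$. (Affine means $T(tx+(1-t)y)=tTx+(1-t)Ty$ for all $x,y\in K$ and $t\in[0,1]$.) -/

import Mathlib

/-- A real normed space is reflexive if the canonical (isometric) embedding `x ↦ (f ↦ f x)` into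
its topological bidual is onto. -/
def IsReflexiveSpace (X : Type*) [NormedAddCommGroup X] [NormedSpace ℝ X] : Prop :=
  Function.Surjective (NormedSpace.inclusionInDoubleDual ℝ X)

/-- `T` is `α`-Hölder nonexpansive on `K`: `ρ (T x) (T y) ≤ ρ (x, y) ^ α` for all `x, y ∈ K`. -/
def HolderNonexpansiveOn {M : Type*} [MetricSpace M] (α : ℝ) (T : M → M) (K : Set M) : Prop :=
  ∀ x ∈ K, ∀ y ∈ K, dist (T x) (T y) ≤ dist x y ^ α

/-- `T` is affine on the (convex) set `K`: it preserves convex combinations of points of `K`. -/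
def IsAffineOn {X : Type*} [AddCommGroup X] [Module ℝ X] (T : X → X) (K : Set X) : Prop :=
  ∀ x ∈ K, ∀ y ∈ K, ∀ t : ℝ, 0 ≤ t → t ≤ 1 →
    T (t • x + (1 - t) • y) = t • T x + (1 - t) • T y

/-- `X` has the fixed point property for `α`-Hölder nonexpansive affine maps: every such self-map
of a nonempty bounded closed convex set `K ⊆ X` has a fixed point in `K`. A self-map of `K` is
given by a function `X → X` that maps `K` into `K`; its values outside `K` play no role. -/
def HasAffineHolderFPP (α : ℝ) (X : Type*) [NormedAddCommGroup X] [NormedSpace ℝ X] : Prop :=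
  ∀ K : Set X, K.Nonempty → Bornology.IsBounded K → IsClosed K → Convex ℝ K →
    ∀ T : X → X, Set.MapsTo T K K → HolderNonexpansiveOn α T K → IsAffineOn T K →
      ∃ x ∈ K, T x = x

open Set Filter Topology NormedSpace

/-! If `X` is reflexive, the sets where `‖T x - x‖ ≤ D / (n + 1)` are nonempty (Cesàro means of an
orbit), closed, convex and nested. Weak compactness gives a common point, which is fixed. If `X` is
not reflexive, James's sequences yield a bounded linear `T` that pushes mass from each `x k` to `x
(k + 1)`. It preserves the closed hull of the `x k`, and a fixed point there would have all its mass
escaped to infinity, which is impossible. Shrinking the hull turns the Lipschitz bound into the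
Hölder one, and linearity keeps the dynamics unchanged. -/

/-! ### Helly's lemma and James's sequences -/

theorem exists_forall_apply_eq_bidual {Y : Type*} [NormedAddCommGroup Y] [NormedSpace ℝ Y]
    {ι : Type*} [Finite ι] (g : ι → StrongDual ℝ Y) (Φ : StrongDual ℝ (StrongDual ℝ Y)) :
    ∃ y, ∀ i, g i y = Φ (g i) := by
  classical
  cases nonempty_fintype ι
  let L : Y →ₗ[ℝ] (ι → ℝ) := LinearMap.pi fun i => (g i : Y →ₗ[ℝ] ℝ)
  by_contra! h
  have hc : (fun i => Φ (g i)) ∉ LinearMap.range L := by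
    rintro ⟨y, hy⟩
    obtain ⟨i, hi⟩ := h y
    exact hi (congrFun hy i)
  obtain ⟨a, ha, haL⟩ := Submodule.exists_dual_map_eq_bot_of_notMem hc inferInstance
  set b : ι → ℝ := fun i => a fun j => if i = j then 1 else 0
  -- A functional killing the range of `L` is a linear relation among the `g i`; `Φ` respects it.
  have key : ∑ i, b i • g i = 0 := by
    ext y
    have h0 : a (L y) = 0 := by
      have : a (L y) ∈ Submodule.map a (LinearMap.range L) := ⟨L y, ⟨y, rfl⟩, rfl⟩
      simpa [haL] using this
    rw [LinearMap.pi_apply_eq_sum_univ] at h0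
    simpa [L, b, mul_comm] using h0
  apply ha
  rw [LinearMap.pi_apply_eq_sum_univ]
  have := congrArg Φ key
  simpa [b, mul_comm] using this

/-- **Helly's lemma**: on finitely many functionals, an element of the bidual agrees with a vector
of almost the same norm. -/
theorem exists_norm_lt_forall_apply_eq_bidual {Y : Type*} [NormedAddCommGroup Y] [NormedSpace ℝ Y]
    {ι : Type*} [Finite ι] (g : ι → StrongDual ℝ Y) (Φ : StrongDual ℝ (StrongDual ℝ Y))
    {ε : ℝ} (hε : 0 < ε) :
    ∃ y, ‖y‖ < ‖Φ‖ + ε ∧ ∀ i, g i y = Φ (g i) := by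
  obtain ⟨y₀, hy₀⟩ := exists_forall_apply_eq_bidual g Φ
  let N : Submodule ℝ Y := ⨅ i, LinearMap.ker (g i : Y →ₗ[ℝ] ℝ)
  obtain ⟨q, hq, hqy⟩ := exists_dual_vector'' ℝ (N.mkQ y₀)
  let h : StrongDual ℝ Y := q.comp N.mkQL
  have hh : ‖h‖ ≤ 1 := by
    refine ContinuousLinearMap.opNorm_le_bound _ zero_le_one fun y => ?_
    calc ‖q (N.mkQ y)‖ ≤ 1 * ‖N.mkQ y‖ := q.le_of_opNorm_le hq _
      _ ≤ 1 * ‖y‖ := by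
        gcongr
        exact Submodule.Quotient.norm_mk_le N y
  -- The functional norming the class of `y₀` vanishes on the common kernel, so it is a combination
  -- of the `g i` and `Φ` evaluates it at `y₀`.
  have hspan : (h : Y →ₗ[ℝ] ℝ) ∈ Submodule.span ℝ (Set.range fun i => (g i : Y →ₗ[ℝ] ℝ)) := by
    refine mem_span_of_iInf_ker_le_ker fun y hy => ?_
    have : N.mkQ y = 0 := (Submodule.Quotient.mk_eq_zero N).2 hy
    change q (N.mkQ y) = 0
    rw [this, map_zero]
  have hΦ : h y₀ = Φ h := by
    cases nonempty_fintype ι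
    obtain ⟨b, hb⟩ := (Submodule.mem_span_range_iff_exists_fun ℝ).1 hspan
    have : h = ∑ i, b i • g i := by
      ext y
      simpa using (LinearMap.congr_fun hb y).symm
    simp [this, hy₀]
  have hle : ‖N.mkQ y₀‖ ≤ ‖Φ‖ := by
    have h1 : h y₀ = ‖N.mkQ y₀‖ := hqy
    rw [← h1, hΦ]
    calc Φ h ≤ ‖Φ h‖ := le_abs_self _
      _ ≤ ‖Φ‖ * ‖h‖ := Φ.le_opNorm h
      _ ≤ ‖Φ‖ * 1 := by gcongr
      _ = ‖Φ‖ := mul_one _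
  obtain ⟨y, hy, hyn⟩ := Submodule.Quotient.norm_mk_lt (N.mkQ y₀) hε
  refine ⟨y, by linarith, fun i => ?_⟩
  have hmem : y - y₀ ∈ N := (Submodule.Quotient.eq N).1 hy
  have := (Submodule.mem_iInf _).1 hmem i
  rw [LinearMap.mem_ker] at this
  have h2 : g i y - g i y₀ = 0 := by simpa using this
  rw [← hy₀ i]
  linarith

theorem IsClosed.exists_dual_eq_one_of_notMem {Z : Type*} [NormedAddCommGroup Z] [NormedSpace ℝ Z]
    {R : Submodule ℝ Z} (hR : IsClosed (R : Set Z)) {x : Z} (hx : x ∉ R) :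
    ∃ Φ : StrongDual ℝ Z, Φ x = 1 ∧ ∀ y ∈ R, Φ y = 0 := by
  have := hR
  obtain ⟨q, hq⟩ := SeparatingDual.exists_eq_one (R := ℝ)
    (mt (Submodule.Quotient.mk_eq_zero R).1 hx)
  refine ⟨q.comp R.mkQL, hq, fun y hy => ?_⟩
  change q (R.mkQ y) = 0
  rw [Submodule.mkQ_apply, (Submodule.Quotient.mk_eq_zero R).2 hy, map_zero]

/-- James's sequences in a nonreflexive Banach space. -/
theorem exists_james_sequences {X : Type*} [NormedAddCommGroup X] [NormedSpace ℝ X]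
    [CompleteSpace X] (hX : ¬ IsReflexiveSpace X) :
    ∃ (C : ℝ) (x : ℕ → X) (f : ℕ → StrongDual ℝ X), 0 < C ∧ (∀ n, ‖x n‖ ≤ C) ∧ (∀ n, ‖f n‖ ≤ C) ∧
      (∀ n k, n ≤ k → f n (x k) = 1) ∧ ∀ n k, k < n → f n (x k) = 0 := by
  classical
  obtain ⟨F, hF⟩ : ∃ F, ∀ x, inclusionInDoubleDual ℝ X x ≠ F := by
    simpa [IsReflexiveSpace, Function.Surjective] using hX
  let R : Submodule ℝ (StrongDual ℝ (StrongDual ℝ X)) :=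
    LinearMap.range (inclusionInDoubleDualLi ℝ (E := X)).toLinearMap
  have hR : IsClosed (R : Set (StrongDual ℝ (StrongDual ℝ X))) :=
    (Isometry.isClosedEmbedding (α := X) (γ := StrongDual ℝ (StrongDual ℝ X))
      (inclusionInDoubleDualLi ℝ (E := X)).isometry).isClosed_range
  have hFR : F ∉ R := fun ⟨x, hx⟩ => hF x hx
  obtain ⟨Φ, hΦF, hΦR⟩ := IsClosed.exists_dual_eq_one_of_notMem
    (Z := StrongDual ℝ (StrongDual ℝ X)) (R := R) hR hFR
  have hΦJ : ∀ x, Φ (inclusionInDoubleDual ℝ X x) = 0 := fun x => hΦR _ ⟨x, rfl⟩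
  obtain ⟨p, hp, hr⟩ := exists_seq_of_forall_finset_exists
    (fun p : X × StrongDual ℝ X =>
      ‖p.1‖ ≤ ‖F‖ + 1 ∧ ‖p.2‖ ≤ ‖Φ‖ + 1 ∧ F p.2 = 1 ∧ p.2 p.1 = 1)
    (fun p p' => p'.2 p.1 = 0 ∧ p.2 p'.1 = 1) (by
      intro s hs
      -- `f` imitates `Φ` on `F` and the earlier vectors (values 1 and 0); then `x` imitates `F` on
      -- `f` and the earlier functionals (value 1).
      obtain ⟨f, hfn, hf⟩ := exists_norm_lt_forall_apply_eq_bidual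
        (fun i : Option s => i.elim F fun p => inclusionInDoubleDual ℝ X p.1.1) Φ one_pos
      have hFf : F f = 1 := (hf none).trans hΦF
      obtain ⟨x, hxn, hx⟩ := exists_norm_lt_forall_apply_eq_bidual
        (fun i : Option s => i.elim f fun p => p.1.2) F one_pos
      refine ⟨(x, f), ⟨hxn.le, hfn.le, hFf, (hx none).trans hFf⟩, fun p hps => ⟨?_, ?_⟩⟩
      · exact (hf (some ⟨p, hps⟩)).trans (hΦJ _)
      · exact (hx (some ⟨p, hps⟩)).trans (hs p hps).2.2.1)
  refine ⟨max (‖F‖ + 1) (‖Φ‖ + 1), fun n => (p n).1, fun n => (p n).2, ?_, ?_, ?_, ?_, ?_⟩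
  · exact lt_max_of_lt_left (by positivity)
  · exact fun n => (hp n).1.trans (le_max_left _ _)
  · exact fun n => (hp n).2.1.trans (le_max_right _ _)
  · intro n k hnk
    rcases hnk.eq_or_lt with rfl | h
    · exact (hp n).2.2.2
    · exact (hr n k h).2
  · exact fun n k h => (hr k n h).1

/-! ### A fixed-point free linear map -/

/-- A nonreflexive Banach space has a bounded closed convex set invariant under a fixed-point free
continuous linear map. -/
theorem exists_mapsTo_fixedPointFree {X : Type*} [NormedAddCommGroup X] [NormedSpace ℝ X]
    [CompleteSpace X] (hX : ¬ IsReflexiveSpace X) :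
    ∃ (K : Set X) (T : X →L[ℝ] X), K.Nonempty ∧ Bornology.IsBounded K ∧ IsClosed K ∧ Convex ℝ K ∧
      MapsTo T K K ∧ ∀ x ∈ K, T x ≠ x := by
  obtain ⟨C, x, f, hC, hx, hf, hf1, hf0⟩ := exists_james_sequences hX
  let t : ℕ → StrongDual ℝ X := fun n => f n - f (n + 1)
  have htn : ∀ n, ‖t n‖ ≤ 2 * C := fun n => by
    have := norm_sub_le (f n) (f (n + 1))
    linarith [hf n, hf (n + 1)]
  have ht1 : ∀ n, t n (x n) = 1 := fun n => by
    simp [t, hf1 n n le_rfl, hf0 (n + 1) n (Nat.lt_succ_self n)]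
  have ht0 : ∀ n k, n ≠ k → t n (x k) = 0 := fun n k h => by
    rcases h.lt_or_gt with h | h
    · simp [t, hf1 n k h.le, hf1 (n + 1) k h]
    · simp [t, hf0 n k h, hf0 (n + 1) k (h.trans (Nat.lt_succ_self n))]
  -- As `t` is biorthogonal to `x`, adding `∑ A n` to the identity moves the fraction `2⁻ᵏ` of `x k`
  -- to `x (k + 1)`. The weights make the series converge.
  let A : ℕ → X →L[ℝ] X := fun n => ((1 / 2 : ℝ) ^ n) • (t n).smulRight (x (n + 1) - x n)
  have hA : Summable A := by
    refine Summable.of_norm_bounded (g := fun n => (1 / 2 : ℝ) ^ n * (2 * C * (2 * C)))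
      (summable_geometric_two.mul_right _) fun n => ?_
    have hd : ‖x (n + 1) - x n‖ ≤ 2 * C := by
      have := norm_sub_le (x (n + 1)) (x n)
      linarith [hx n, hx (n + 1)]
    simp only [A, norm_smul, ContinuousLinearMap.norm_smulRight_apply, norm_pow]
    rw [Real.norm_of_nonneg (by norm_num : (0 : ℝ) ≤ 1 / 2)]
    gcongr
    exact htn n
  have hAs : ∀ y, HasSum (fun n => A n y) ((∑' n, A n) y) := fun y =>
    hA.hasSum.mapL (ContinuousLinearMap.apply ℝ X y)
  have hAx : ∀ k, (∑' n, A n) (x k) = ((1 / 2 : ℝ) ^ k) • (x (k + 1) - x k) := fun k => by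
    refine (hAs (x k)).unique ?_
    have h : A k (x k) = ((1 / 2 : ℝ) ^ k) • (x (k + 1) - x k) := by simp [A, ht1]
    rw [← h]
    exact hasSum_single k fun n hn => by simp [A, ht0 n k hn]
  let T : X →L[ℝ] X := ContinuousLinearMap.id ℝ X + ∑' n, A n
  let H := convexHull ℝ (range x)
  have hHconv : Convex ℝ H := convex_convexHull ℝ _
  have hxH : ∀ n, x n ∈ H := fun n => subset_convexHull ℝ _ ⟨n, rfl⟩
  have hTH : MapsTo T H H := by
    refine convexHull_min (t := T ⁻¹' H) ?_ (hHconv.linear_preimage (T : X →ₗ[ℝ] X))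
    rintro _ ⟨k, rfl⟩
    have : T (x k) = (1 - (1 / 2 : ℝ) ^ k) • x k + ((1 / 2 : ℝ) ^ k) • x (k + 1) := by
      simp only [T, add_apply, hAx, ContinuousLinearMap.id_apply]
      module
    rw [mem_preimage, this]
    exact hHconv (hxH k) (hxH (k + 1))
      (sub_nonneg.2 (pow_le_one₀ (by norm_num) (by norm_num))) (by positivity) (by ring)
  have hf0K : ∀ y ∈ closure H, f 0 y = 1 := by
    have : IsClosed {y | f 0 y = 1} := isClosed_eq (f 0).continuous continuous_const
    refine closure_minimal (convexHull_min ?_ ?_) this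
    · rintro _ ⟨k, rfl⟩
      exact hf1 0 k (Nat.zero_le k)
    · exact convex_hyperplane (f 0 : X →ₗ[ℝ] ℝ).isLinear 1
  have hftail : ∀ y ∈ H, ∃ N, ∀ n ≥ N, f n y = 0 := by
    refine convexHull_min (t := {y | ∃ N, ∀ n ≥ N, f n y = 0}) ?_ ?_
    · rintro _ ⟨k, rfl⟩
      exact ⟨k + 1, fun n hn => hf0 n k hn⟩
    · rintro y ⟨N, hN⟩ z ⟨M, hM⟩ a b - - -
      exact ⟨max N M, fun n hn => by
        simp [hN n ((le_max_left _ _).trans hn), hM n ((le_max_right _ _).trans hn)]⟩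
  refine ⟨closure H, T, ⟨x 0, subset_closure (hxH 0)⟩, ?_, isClosed_closure, hHconv.closure,
    hTH.closure T.continuous, fun y hy hTy => ?_⟩
  · refine ((isBounded_convexHull (s := range x)).2 ?_).closure
    rw [isBounded_iff_forall_norm_le]
    exact ⟨C, by rintro _ ⟨n, rfl⟩; exact hx n⟩
  · have hsum : HasSum (fun n => A n y) 0 := by
      have h := hAs y
      have h2 : y + (∑' n, A n) y = y := hTy
      rwa [add_eq_left.1 h2] at h
    have hdiff : ∀ m n, t m (A n y) = ((1 / 2 : ℝ) ^ n) * t n y *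
        (t m (x (n + 1)) - t m (x n)) := fun m n => by
      simp [A, mul_assoc]
    -- `t m` sees only the outflow from `x m` and the inflow from `x (m - 1)`; the inflow is zero by
    -- induction, hence so is the outflow.
    have htzero : ∀ m, t m y = 0 := by
      intro m
      have hs := hsum.mapL (t m)
      rw [map_zero] at hs
      induction m with
      | zero =>
        have h2 : HasSum (fun n => t 0 (A n y)) (t 0 (A 0 y)) :=
          hasSum_single 0 fun n hn => by
            rw [hdiff, ht0 0 (n + 1) (by omega), ht0 0 n (by omega)]
            ring
        have h3 := h2.unique hs
        rw [hdiff, ht1, ht0 0 1 (by omega)] at h3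
        simpa using h3
      | succ m ih =>
        have hm := ih (by simpa using hsum.mapL (t m))
        have h2 : HasSum (fun n => t (m + 1) (A n y)) (t (m + 1) (A (m + 1) y)) :=
          hasSum_single (m + 1) fun n hn => by
            rw [hdiff]
            by_cases h : n = m
            · rw [h, hm]
              ring
            · rw [ht0 (m + 1) (n + 1) (by omega), ht0 (m + 1) n (by omega)]
              ring
        have h3 := h2.unique hs
        rw [hdiff, ht1, ht0 (m + 1) (m + 1 + 1) (by omega)] at h3
        simpa using h3
    have hfy : ∀ n, f n y = 1 := by
      intro n
      induction n with
      | zero => exact hf0K y hy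
      | succ n ih =>
        have h : f n y - f (n + 1) y = 0 := htzero n
        linarith
    -- All `f n` equal 1 at `y` but eventually vanish at any `z` in the hull, so the bound `C` on
    -- their norms forces `‖y - z‖ ≥ 1 / C`.
    obtain ⟨z, hz, hyz⟩ := Metric.mem_closure_iff.1 hy (1 / C) (by positivity)
    obtain ⟨N, hN⟩ := hftail z hz
    have h1 : f N (y - z) = 1 := by rw [map_sub, hfy, hN N le_rfl, sub_zero]
    have h2 : ‖f N (y - z)‖ ≤ C * ‖y - z‖ := (f N).le_of_opNorm_le (hf N) _
    rw [dist_eq_norm, lt_div_iff₀ hC] at hyz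
    rw [h1, norm_one] at h2
    linarith

/-! ### From Lipschitz to Hölder by scaling -/

theorem holderNonexpansiveOn_of_dist_le_mul {M : Type*} [MetricSpace M] {α L D : ℝ} {T : M → M}
    {K : Set M} (hα0 : 0 < α) (hα1 : α < 1) (hL : 0 ≤ L)
    (hT : ∀ x ∈ K, ∀ y ∈ K, dist (T x) (T y) ≤ L * dist x y)
    (hD : ∀ x ∈ K, ∀ y ∈ K, dist x y ≤ D) (hLD : L * D ^ (1 - α) ≤ 1) :
    HolderNonexpansiveOn α T K := by
  intro x hx y hy
  have hsplit : dist x y = dist x y ^ (1 - α) * dist x y ^ α := by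
    rw [← Real.rpow_add_of_nonneg dist_nonneg (sub_nonneg.2 hα1.le) hα0.le]
    simp
  calc dist (T x) (T y) ≤ L * dist x y := hT x hx y hy
    _ = L * dist x y ^ (1 - α) * dist x y ^ α := by rw [mul_assoc, ← hsplit]
    _ ≤ L * D ^ (1 - α) * dist x y ^ α := by
      gcongr
      exact hD x hx y hy
    _ ≤ 1 * dist x y ^ α := by gcongr
    _ = dist x y ^ α := one_mul _

theorem HasAffineHolderFPP.exists_fixedPoint {X : Type*} [NormedAddCommGroup X] [NormedSpace ℝ X]
    {α : ℝ} (hα0 : 0 < α) (hα1 : α < 1) (h : HasAffineHolderFPP α X) {K : Set X}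
    (hne : K.Nonempty) (hb : Bornology.IsBounded K) (hc : IsClosed K) (hconv : Convex ℝ K)
    (T : X →L[ℝ] X) (hT : MapsTo T K K) : ∃ x ∈ K, T x = x := by
  obtain ⟨D, hD0, hD⟩ : ∃ D : ℝ, 0 < D ∧ ∀ x ∈ K, ∀ y ∈ K, dist x y ≤ D := by
    obtain ⟨D, hD⟩ := Metric.isBounded_iff.1 hb
    exact ⟨max D 1, by positivity, fun x hx y hy => (hD hx hy).trans (le_max_left _ _)⟩
  obtain ⟨s, hs0, hs⟩ : ∃ s : ℝ, 0 < s ∧ ‖T‖ * (s * D) ^ (1 - α) ≤ 1 := by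
    have hα : 0 < 1 - α := by linarith
    -- Chosen so that `(s * D) ^ (1 - α) = 1 / (‖T‖ + 1)`.
    refine ⟨(1 / (‖T‖ + 1)) ^ (1 - α)⁻¹ / D, by positivity, ?_⟩
    rw [div_mul_cancel₀ _ hD0.ne', ← Real.rpow_mul (by positivity), inv_mul_cancel₀ hα.ne',
      Real.rpow_one, mul_one_div, div_le_one (by positivity)]
    linarith
  obtain ⟨x, hx, hTx⟩ := h ((fun x => s • x) '' K) (hne.image _)
    ((lipschitzWith_smul s).isBounded_image hb)
    ((Homeomorph.smulOfNeZero s hs0.ne').isClosedMap _ hc) (hconv.smul s) T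
    (by rintro _ ⟨x, hx, rfl⟩; exact ⟨T x, hT hx, (T.map_smul s x).symm⟩)
    (holderNonexpansiveOn_of_dist_le_mul hα0 hα1 (norm_nonneg T)
      (fun x _ y _ => by simpa only [dist_eq_norm, ← map_sub] using T.le_opNorm (x - y))
      (by
        rintro _ ⟨x, hx, rfl⟩ _ ⟨y, hy, rfl⟩
        simp only [dist_smul₀, Real.norm_of_nonneg hs0.le]
        gcongr
        exact hD x hx y hy) hs)
    (fun x _ y _ t _ _ => by simp)
  obtain ⟨y, hy, rfl⟩ := hx
  refine ⟨y, hy, smul_right_injective X hs0.ne' ?_⟩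
  simpa using hTx

/-! ### Fixed points in reflexive spaces -/

/-- By Banach–Alaoglu, points chosen in the `F n` converge weak-* in the bidual along an
ultrafilter. Reflexivity puts the limit in `X`, and Hahn–Banach separation keeps it in every `F n`.
-/
theorem IsReflexiveSpace.nonempty_iInter {X : Type*} [NormedAddCommGroup X] [NormedSpace ℝ X]
    (hX : IsReflexiveSpace X) {F : ℕ → Set X} (hF : Antitone F) (hne : ∀ n, (F n).Nonempty)
    (hb : Bornology.IsBounded (F 0)) (hc : ∀ n, IsClosed (F n)) (hconv : ∀ n, Convex ℝ (F n)) :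
    (⋂ n, F n).Nonempty := by
  choose u hu using hne
  obtain ⟨C, hC⟩ := isBounded_iff_forall_norm_le.1 hb
  let j : ℕ → WeakDual ℝ (StrongDual ℝ X) := fun n =>
    StrongDual.toWeakDual (inclusionInDoubleDual ℝ X (u n))
  let U : Ultrafilter ℕ := hyperfilter ℕ
  obtain ⟨Φ, -, hΦ⟩ := (WeakDual.isCompact_closedBall (𝕜 := ℝ)
    (0 : StrongDual ℝ (StrongDual ℝ X)) C).ultrafilter_le_nhds (U.map j) (by
      rw [le_principal_iff]
      refine Filter.mem_map.2 (Filter.univ_mem' fun n => ?_)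
      change inclusionInDoubleDual ℝ X (u n) ∈ Metric.closedBall _ C
      refine (mem_closedBall_zero_iff (E := StrongDual ℝ (StrongDual ℝ X))).2 ?_
      exact (double_dual_bound ℝ X _).trans (hC _ (hF (Nat.zero_le n) (hu n))))
  obtain ⟨x, hx⟩ := hX (WeakDual.toStrongDual Φ)
  have hlim : ∀ f : StrongDual ℝ X, Tendsto (fun n => f (u n)) U (𝓝 (f x)) := by
    intro f
    have h1 : Tendsto (fun n => j n f) U (𝓝 (Φ f)) :=
      ((WeakDual.eval_continuous f).tendsto Φ).comp (f := j) hΦ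
    have h2 : Φ f = f x := by
      rw [← dual_def ℝ X x f, hx]
      rfl
    rwa [h2] at h1
  refine ⟨x, mem_iInter.2 fun n => ?_⟩
  by_contra hxn
  obtain ⟨f, c, hfx, hfc⟩ := geometric_hahn_banach_point_closed (hconv n) (hc n) hxn
  have hev : ∀ᶠ m in (U : Filter ℕ), n ≤ m :=
    (Nat.hyperfilter_le_atTop : (U : Filter ℕ) ≤ atTop) (eventually_ge_atTop n)
  exact hfx.not_ge (ge_of_tendsto (hlim f) (hev.mono fun m hm => (hfc _ (hF hm (hu m))).le))

theorem HolderNonexpansiveOn.continuousOn {M : Type*} [MetricSpace M] {α : ℝ} {T : M → M}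
    {K : Set M} (hα : 0 < α) (hT : HolderNonexpansiveOn α T K) : ContinuousOn T K := by
  intro x hx
  rw [ContinuousWithinAt, tendsto_iff_dist_tendsto_zero]
  have h : Tendsto (fun y => dist y x ^ α) (𝓝[K] x) (𝓝 0) := by
    have : Continuous fun y => dist y x ^ α :=
      (continuous_id.dist continuous_const).rpow_const fun _ => Or.inr hα.le
    have h := this.tendsto x
    simp only [dist_self, Real.zero_rpow hα.ne'] at h
    exact h.mono_left nhdsWithin_le_nhds
  refine squeeze_zero' (.of_forall fun _ => dist_nonneg) ?_ h
  filter_upwards [self_mem_nhdsWithin] with y hy using hT y hy x hx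

theorem exists_norm_affine_sub_le {X : Type*} [NormedAddCommGroup X] [NormedSpace ℝ X]
    {K : Set X} (hconv : Convex ℝ K) {T : X → X} (hT : MapsTo T K K) (ha : IsAffineOn T K)
    {D : ℝ} (hD : ∀ x ∈ K, ∀ y ∈ K, dist x y ≤ D) {x : X} (hx : x ∈ K) (n : ℕ) :
    ∃ y ∈ K, ‖T y - y‖ ≤ D / (n + 1) := by
  have hit : ∀ k, T^[k] x ∈ K := fun k => hT.iterate k hx
  -- The witness is the mean of `x, T x, …, T^[n] x`, for which `T y - y` telescopes; the induction
  -- updates this mean one iterate at a time.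
  suffices h : ∃ y ∈ K, T y = y + ((n : ℝ) + 1)⁻¹ • (T^[n + 1] x - x) by
    obtain ⟨y, hy, he⟩ := h
    refine ⟨y, hy, ?_⟩
    rw [he, add_sub_cancel_left, norm_smul, ← dist_eq_norm, Real.norm_of_nonneg (by positivity), ← div_eq_inv_mul]
    gcongr
    exact hD _ (hit _) _ hx
  induction n with
  | zero => exact ⟨x, hx, by simp⟩
  | succ n ih =>
    obtain ⟨y, hy, hTy⟩ := ih
    set t : ℝ := (n + 1) / (n + 2)
    have ht0 : 0 ≤ t := by positivity
    have ht1 : t ≤ 1 := by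
      rw [div_le_one (by positivity)]
      linarith
    refine ⟨t • y + (1 - t) • T^[n + 1] x,
      hconv hy (hit _) ht0 (sub_nonneg.2 ht1) (by ring), ?_⟩
    rw [ha _ hy _ (hit _) t ht0 ht1, hTy, ← Function.iterate_succ_apply' T (n + 1) x]
    have h1 : t * ((n : ℝ) + 1)⁻¹ = (((n + 1 : ℕ) : ℝ) + 1)⁻¹ := by
      simp only [t]
      push_cast
      field_simp
      ring
    have h2 : 1 - t = (((n + 1 : ℕ) : ℝ) + 1)⁻¹ := by
      simp only [t]
      push_cast
      field_simp
      ring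
    rw [smul_add, smul_smul, h1, h2]
    module

theorem IsReflexiveSpace.hasAffineHolderFPP {X : Type*} [NormedAddCommGroup X] [NormedSpace ℝ X]
    (hX : IsReflexiveSpace X) {α : ℝ} (hα : 0 < α) : HasAffineHolderFPP α X := by
  intro K hne hb hc hconv T hT hH ha
  obtain ⟨D, hD⟩ := Metric.isBounded_iff.1 hb
  obtain ⟨x₀, hx₀⟩ := hne
  have hD0 : 0 ≤ D := dist_nonneg.trans (hD hx₀ hx₀)
  let F : ℕ → Set X := fun n => {x ∈ K | ‖T x - x‖ ≤ D / (n + 1)}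
  obtain ⟨x, hx⟩ := hX.nonempty_iInter (F := F)
    (fun m n hmn x hx => ⟨hx.1, hx.2.trans (by gcongr)⟩)
    (fun n => exists_norm_affine_sub_le hconv hT ha (fun x hx y hy => hD hx hy) hx₀ n)
    (hb.subset fun x hx => hx.1)
    (fun n => ((hH.continuousOn hα).sub continuousOn_id).norm.preimage_isClosed_of_isClosed hc
      isClosed_Iic)
    (by
      rintro n x ⟨hx, hxn⟩ y ⟨hy, hyn⟩ a b h0 hb0 hab
      obtain rfl : b = 1 - a := by linarith
      refine ⟨hconv hx hy h0 hb0 hab, ?_⟩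
      rw [ha x hx y hy a h0 (by linarith)]
      calc ‖a • T x + (1 - a) • T y - (a • x + (1 - a) • y)‖
          = ‖a • (T x - x) + (1 - a) • (T y - y)‖ := by congr 1; module
        _ ≤ a * ‖T x - x‖ + (1 - a) * ‖T y - y‖ := by
          refine (norm_add_le _ _).trans_eq ?_
          rw [norm_smul, norm_smul, Real.norm_of_nonneg h0, Real.norm_of_nonneg hb0]
        _ ≤ a * (D / (n + 1)) + (1 - a) * (D / (n + 1)) := by gcongr
        _ = D / (n + 1) := by ring)
  rw [mem_iInter] at hx
  refine ⟨x, (hx 0).1, ?_⟩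
  have hlim : Tendsto (fun n : ℕ => D / ((n : ℝ) + 1)) atTop (𝓝 0) :=
    tendsto_const_div_atTop_nhds_zero_nat D |>.comp (tendsto_add_atTop_nat 1) |>.congr
      fun n => by simp
  have h0 : ‖T x - x‖ ≤ 0 := ge_of_tendsto' hlim fun n => (hx n).2
  exact sub_eq_zero.1 (norm_le_zero_iff.1 h0)

theorem corollary3p7 {X : Type*} [NormedAddCommGroup X] [NormedSpace ℝ X] [CompleteSpace X]
    (α : ℝ) (hα0 : 0 < α) (hα1 : α < 1) :
    IsReflexiveSpace X ↔ HasAffineHolderFPP α X := by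
  refine ⟨fun h => h.hasAffineHolderFPP hα0, fun h => ?_⟩
  by_contra hX
  obtain ⟨K, T, hne, hb, hc, hconv, hT, hfix⟩ := exists_mapsTo_fixedPointFree hX
  obtain ⟨x, hx, hTx⟩ := h.exists_fixedPoint hα0 hα1 hne hb hc hconv T hT
  exact hfix x hx hTx
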